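/- Let $M(y)$ be a regular complex $n\times n$ matrix polynomial ($\det M\not\equiv 0$), and let $N(\lambda)=M(\lambda+\lambda^{-1})$ for $\lambda\ne 0$. For a matrix function $F$ analytic near $z_0$, vectors $x_0,\dots,x_{\ell-1}\in\mathbb{C}^n$ ($\ell\ge 1$) form a Jordan chain of length $\ell$ of $F$ at $z_0$ if $x_0\neq 0$ and $\sum_{i=0}^m \frac{F^{(m-i)}(z_0)}{(m-i)!}x_i=0$ for $m=0,\dots,\ell-1$. A canonical set of Jordan chains of $F$ at $z_0$ is a finite sequence of Jordan chains whose leading vectors $x^{(1)}_0,\dots,x^{(r)}_0$ form a basis of $\ker F(z_0)$ and such that, for each $i$, the length of the $i$-th chain is the largest length of any Jordan chain of $F$ at $z_0$ whose leading vector does not lie in $\mathrm{span}(x^{(1)}_0,\dots,x^{(i-1)}_0)$. The Jordan structure of $F$ at $z_0$ is the multiset of the lengths of the chains in a canonical set (empty if $F(z_0)$ is invertible). Then at every $y_0\in\mathbb{C}$ the Jordan structure of $M$ exists and does not depend on the canonical set chosen, and: 1. If $\lambda_0\in\mathbb{C}\setminus\{0,1,-1\}$ and $y_0=\lambda_0+\lambda_0^{-1}$,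 then the Jordan structure of $M$ at $y_0$ equals the Jordan structure of $N$ at $\lambda_0$, and equally the Jordan structure of $N$ at $1/\lambda_0$. 2. If $\lambda_0=\pm 1$, then for every $\ell$ there is a Jordan chain of length $\ell$ of $M$ at $\pm 2$ if and only if there is a Jordan chain of length $2\ell$ of $N$ at $\pm1$ (same sign). Moreover, the Jordan structure of $N$ at $\pm 1$ is obtained from that of $M$ at $\pm 2$ by doubling every length. -/

import Mathlib

open scoped Nat Matrix

namespace JordanChains

/-- The matrix function `y ↦ M(y)` of a matrix polynomial `M`. -/
noncomputable def evalFun {n : ℕ} (M : Matrix (Fin n) (Fin n) (Polynomial ℂ)) :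
    ℂ → Matrix (Fin n) (Fin n) ℂ :=
  fun y => M.map (Polynomial.eval y)

/-- The matrix function `N(z) = M(z + 1/z)`, meant for `z ≠ 0`. -/
noncomputable def dicksonFun {n : ℕ} (M : Matrix (Fin n) (Fin n) (Polynomial ℂ)) :
    ℂ → Matrix (Fin n) (Fin n) ℂ :=
  fun z => evalFun M (z + z⁻¹)

/-- The coefficient `F^{(k)}(z₀) / k!`, with entrywise derivatives, of a matrix function `F`
that is analytic near `z₀`. -/
noncomputable def taylorCoeff {n : ℕ} (F : ℂ → Matrix (Fin n) (Fin n) ℂ) (z₀ : ℂ) (k : ℕ) :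
    Matrix (Fin n) (Fin n) ℂ :=
  Matrix.of fun i j => iteratedDeriv k (fun z => F z i j) z₀ / (k ! : ℂ)

/-- `x 0, …, x (ℓ - 1)` is a Jordan chain of length `ℓ ≥ 1` of `F` at `z₀`.
The values `x i` with `ℓ ≤ i` play no role. -/
structure IsJordanChain {n : ℕ} (F : ℂ → Matrix (Fin n) (Fin n) ℂ) (z₀ : ℂ) (ℓ : ℕ)
    (x : ℕ → Fin n → ℂ) : Prop where
  length_pos : 0 < ℓ
  head_ne_zero : x 0 ≠ 0
  chain : ∀ m < ℓ, ∑ i ∈ Finset.range (m + 1), taylorCoeff F z₀ (m - i) *ᵥ x i = 0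

/-- A canonical set of Jordan chains `x i` of lengths `ℓ i` (for `i < r`) of `F` at `z₀`: the
leading vectors form a basis of `ker F(z₀)`, and each chain is as long as any Jordan chain whose
leading vector is not in the span of the leading vectors of the previous chains. -/
structure IsCanonicalSet {n : ℕ} (F : ℂ → Matrix (Fin n) (Fin n) ℂ) (z₀ : ℂ) {r : ℕ}
    (ℓ : Fin r → ℕ) (x : Fin r → ℕ → Fin n → ℂ) : Prop where
  isJordanChain : ∀ i, IsJordanChain F z₀ (ℓ i) (x i)
  linearIndependent : LinearIndependent ℂ fun i => x i 0
  span_eq : Submodule.span ℂ (Set.range fun i => x i 0) = LinearMap.ker (F z₀).mulVecLin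
  maximal : ∀ (i : Fin r) (m : ℕ) (z : ℕ → Fin n → ℂ), IsJordanChain F z₀ m z →
    z 0 ∉ Submodule.span ℂ ((fun j => x j 0) '' {j | j < i}) → m ≤ ℓ i

/-- The multiset `s` is the Jordan structure of `F` at `z₀`: it lists the lengths of the chains of
a canonical set of Jordan chains (it is empty if `z₀` is not an eigenvalue). -/
def HasJordanStructure {n : ℕ} (F : ℂ → Matrix (Fin n) (Fin n) ℂ) (z₀ : ℂ)
    (s : Multiset ℕ) : Prop :=
  ∃ (r : ℕ) (ℓ : Fin r → ℕ) (x : Fin r → ℕ → Fin n → ℂ),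
    IsCanonicalSet F z₀ ℓ x ∧ s = Finset.univ.val.map ℓ

end JordanChains

/-!
The proof rests on the filtration of `ℂⁿ` by the spaces `headSpace F z₀ m` of leading vectors of
Jordan chains of length `m`. In a canonical set, the leading vectors of the chains of length at
least `m` form a basis of `headSpace F z₀ m`, so a multiset of positive numbers is the Jordan
structure of `F` at `z₀` if and only if the number of its elements `≥ m` is
`dim (headSpace F z₀ m)` for all `m > 0` (`hasJordanStructure_iff`). This gives uniqueness.
Existence only needs these spaces to vanish for large `m`, which for a regular matrix polynomial
follows by multiplying with the adjugate (`exists_headSpace_eq_bot`).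

It remains to compare the filtrations of `N = M ∘ g`, `g z = z + 1 / z`, and of `M`. If `g - g z₀`
vanishes to order `e` at `z₀`, then modulo any power of `z - z₀` every vector function near `z₀`
has an expansion `x = ∑ k < e, (z - z₀) ^ k • y k (g z - g z₀)` with vector polynomials `y k`
(`exists_expansion`). Then `N x` has the analogous expansion with `M (g z₀ + ·) (y k)` in place of
`y k`, and the terms of such an expansion have distinct orders
(`coeff_eq_zero_of_dvd_expansion`), so that `N x` vanishes to order `m` only if
`M (g z₀ + ·) (y 0)` vanishes to order `⌈m / e⌉`. Hence
`headSpace N z₀ m = headSpace M (g z₀) ⌈m / e⌉` (`headSpace_comp`). Here `e = 1` if `z₀ ≠ ±1`,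
which gives equal Jordan structures, and `e = 2` if `z₀ = ±1`, where the dimensions
`dim (headSpace M (g z₀) ⌈m / 2⌉)` are those that belong to the doubled lengths.
-/

namespace JordanChains

variable {n : ℕ}

/-! ### The spaces of leading vectors -/

/-- The space of leading vectors `x 0` of the sequences that satisfy the first `m` Jordan chain
equations of `F` at `z₀`. Its nonzero elements are the leading vectors of the Jordan chains of
length `m`, if `m` is positive. -/
def headSpace (F : ℂ → Matrix (Fin n) (Fin n) ℂ) (z₀ : ℂ) (m : ℕ) :
    Submodule ℂ (Fin n → ℂ) where
  carrier := {v | ∃ x : ℕ → Fin n → ℂ, x 0 = v ∧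
    ∀ k < m, ∑ i ∈ Finset.range (k + 1), taylorCoeff F z₀ (k - i) *ᵥ x i = 0}
  add_mem' := by
    rintro _ _ ⟨x, rfl, hx⟩ ⟨y, rfl, hy⟩
    refine ⟨x + y, rfl, fun k hk => ?_⟩
    simp [Matrix.mulVec_add, Finset.sum_add_distrib, hx k hk, hy k hk]
  zero_mem' := ⟨0, rfl, fun k _ => by simp⟩
  smul_mem' := by
    rintro c _ ⟨x, rfl, hx⟩
    refine ⟨c • x, rfl, fun k hk => ?_⟩
    simp [Matrix.mulVec_smul, ← Finset.smul_sum, hx k hk]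

variable {F : ℂ → Matrix (Fin n) (Fin n) ℂ} {z₀ : ℂ}

lemma headSpace_antitone : Antitone (headSpace F z₀) := by
  rintro a b hab _ ⟨x, rfl, hx⟩
  exact ⟨x, rfl, fun k hk => hx k (hk.trans_le hab)⟩

lemma headSpace_one : headSpace F z₀ 1 = LinearMap.ker (F z₀).mulVecLin := by
  have h : taylorCoeff F z₀ 0 = F z₀ := by ext i j; simp [taylorCoeff]
  ext v
  simp only [LinearMap.mem_ker, Matrix.mulVecLin_apply]
  constructor
  · rintro ⟨x, rfl, hx⟩
    simpa [h] using hx 0 one_pos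
  · refine fun hv => ⟨fun _ => v, rfl, fun k hk => ?_⟩
    obtain rfl : k = 0 := by lia
    simpa [h] using hv

lemma IsJordanChain.head_mem {ℓ : ℕ} {x : ℕ → Fin n → ℂ} (h : IsJordanChain F z₀ ℓ x) :
    x 0 ∈ headSpace F z₀ ℓ := ⟨x, rfl, h.chain⟩

lemma exists_isJordanChain_of_mem {ℓ : ℕ} (hℓ : 0 < ℓ) {v : Fin n → ℂ}
    (hv : v ∈ headSpace F z₀ ℓ) (h0 : v ≠ 0) : ∃ x, IsJordanChain F z₀ ℓ x ∧ x 0 = v := by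
  obtain ⟨x, rfl, hx⟩ := hv
  exact ⟨x, ⟨hℓ, h0, hx⟩, rfl⟩

lemma exists_isJordanChain_iff {ℓ : ℕ} :
    (∃ x, IsJordanChain F z₀ ℓ x) ↔ 0 < ℓ ∧ headSpace F z₀ ℓ ≠ ⊥ := by
  constructor
  · rintro ⟨x, hx⟩
    exact ⟨hx.length_pos, Submodule.ne_bot_iff _ |>.2 ⟨_, hx.head_mem, hx.head_ne_zero⟩⟩
  · rintro ⟨hℓ, h⟩
    obtain ⟨v, hv, h0⟩ := Submodule.ne_bot_iff _ |>.1 h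
    obtain ⟨x, hx, -⟩ := exists_isJordanChain_of_mem hℓ hv h0
    exact ⟨x, hx⟩

/-! ### Canonical sets and the dimensions of the spaces of leading vectors -/

/-- The leading vectors of the chains of length at least `m` in a canonical set span
`headSpace F z₀ m`: the first chain shorter than `m` could otherwise be replaced by a longer one. -/
lemma IsCanonicalSet.card_le_length {r : ℕ} {ℓ : Fin r → ℕ} {x : Fin r → ℕ → Fin n → ℂ}
    (h : IsCanonicalSet F z₀ ℓ x) {m : ℕ} (hm : 0 < m) :
    Fintype.card {i // m ≤ ℓ i} = Module.finrank ℂ (headSpace F z₀ m) := by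
  have hli : LinearIndependent ℂ fun i : {i // m ≤ ℓ i} => x i 0 :=
    h.linearIndependent.comp _ Subtype.val_injective
  rw [← finrank_span_eq_card hli]
  suffices hs : Submodule.span ℂ (Set.range fun i : {i // m ≤ ℓ i} => x i 0) =
      headSpace F z₀ m by rw [hs]
  apply le_antisymm
  · rw [Submodule.span_le]
    rintro _ ⟨i, rfl⟩
    exact headSpace_antitone i.2 (h.isJordanChain i).head_mem
  intro v hv
  by_contra hvs
  by_cases hall : ∀ i, m ≤ ℓ i
  · have hk : v ∈ Submodule.span ℂ (Set.range fun i => x i 0) := by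
      rw [h.span_eq, ← headSpace_one]
      exact headSpace_antitone hm hv
    refine hvs (Submodule.span_mono ?_ hk)
    rintro _ ⟨i, rfl⟩
    exact ⟨⟨i, hall i⟩, rfl⟩
  · push Not at hall
    obtain ⟨i, hi, hmin⟩ := WellFounded.has_min (wellFounded_lt (α := Fin r))
      {i | ℓ i < m} hall
    have hv0 : v ≠ 0 := fun h0 => hvs (h0 ▸ Submodule.zero_mem _)
    obtain ⟨z, hz, rfl⟩ := exists_isJordanChain_of_mem hm hv hv0
    have := h.maximal i m z hz fun hzs => hvs <| Submodule.span_mono (by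
      rintro _ ⟨j, hj, rfl⟩
      exact ⟨⟨j, not_lt.1 fun hjm => hmin j hjm hj⟩, rfl⟩) hzs
    exact absurd hi (not_lt.2 this)

/-- Longest chains can be chosen one after the other, as long as the kernel is not exhausted,
if there is a bound on the lengths. -/
lemma exists_isCanonicalSet {L : ℕ} (hL : headSpace F z₀ L = ⊥) :
    ∃ (r : ℕ) (ℓ : Fin r → ℕ) (x : Fin r → ℕ → Fin n → ℂ), IsCanonicalSet F z₀ ℓ x := by
  let P : ℕ → Prop := fun r => ∃ (ℓ : Fin r → ℕ) (x : Fin r → ℕ → Fin n → ℂ),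
    (∀ i, IsJordanChain F z₀ (ℓ i) (x i)) ∧ (LinearIndependent ℂ fun i => x i 0) ∧
    ∀ (i : Fin r) (m : ℕ) (z : ℕ → Fin n → ℂ), IsJordanChain F z₀ m z →
      z 0 ∉ Submodule.span ℂ ((fun j => x j 0) '' {j | j < i}) → m ≤ ℓ i
  have hP0 : P 0 := ⟨Fin.elim0, Fin.elim0, fun i => i.elim0, linearIndependent_empty_type,
    fun i => i.elim0⟩
  have hPn : ∀ r, P r → r ≤ n := by
    rintro r ⟨ℓ, x, -, hli, -⟩
    simpa using hli.fintype_card_le_finrank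
  classical
  have hPr := Nat.findGreatest_spec (P := P) (Nat.zero_le n) hP0
  have hmax : ¬ P (Nat.findGreatest P n + 1) := fun h =>
    Nat.not_succ_le_self _ (Nat.le_findGreatest (hPn _ h) h)
  generalize Nat.findGreatest P n = r at hPr hmax
  obtain ⟨ℓ, x, hc, hli, hm⟩ := hPr
  refine ⟨r, ℓ, x, hc, hli, ?_, hm⟩
  set S := Submodule.span ℂ (Set.range fun i => x i 0) with hS
  rw [← headSpace_one]
  apply le_antisymm
  · rw [hS, Submodule.span_le]
    rintro _ ⟨i, rfl⟩
    exact headSpace_antitone (hc i).length_pos (hc i).head_mem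
  by_contra hle
  refine hmax ?_
  let Q : ℕ → Prop := fun m => ¬ headSpace F z₀ m ≤ S
  have hQ : ∀ m, Q m → m ≤ L := by
    intro m hQm
    by_contra hlt
    exact hQm ((headSpace_antitone (not_le.1 hlt).le).trans (hL ▸ bot_le))
  have hQk : Q (Nat.findGreatest Q L) := Nat.findGreatest_spec (P := Q) (hQ 1 hle) hle
  have hQmax : ∀ m, Q m → m ≤ Nat.findGreatest Q L := fun m h =>
    Nat.le_findGreatest (hQ m h) h
  generalize Nat.findGreatest Q L = k at hQk hQmax
  obtain ⟨v, hv, hvS⟩ := Set.not_subset.1 hQk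
  have hv0 : v ≠ 0 := fun h0 => hvS (h0 ▸ Submodule.zero_mem _)
  obtain ⟨z, hz, rfl⟩ := exists_isJordanChain_of_mem (hQmax 1 hle) hv hv0
  have hsnoc : (fun i => (Fin.snoc x z : Fin (r + 1) → ℕ → Fin n → ℂ) i 0) =
      Fin.snoc (fun i => x i 0) (z 0) := by
    funext i
    refine Fin.lastCases ?_ (fun j => ?_) i <;> simp
  refine ⟨Fin.snoc ℓ k, Fin.snoc x z, fun i => ?_, ?_, fun i => ?_⟩
  · refine Fin.lastCases ?_ (fun j => ?_) i
    · simpa using hz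
    · simpa using hc j
  · rw [hsnoc]
    exact hli.finSnoc hvS
  · rw [hsnoc]
    refine Fin.lastCases ?_ (fun j => ?_) i
    · intro m w hw hwS
      rw [Fin.snoc_last]
      refine hQmax m fun hle' => hwS (Submodule.span_mono ?_ (hle' hw.head_mem))
      rintro _ ⟨j, rfl⟩
      exact ⟨j.castSucc, j.castSucc_lt_last, by simp⟩
    · intro m w hw hwS
      rw [Fin.snoc_castSucc]
      refine hm j m w hw fun hwm => hwS (Submodule.span_mono ?_ hwm)
      rintro _ ⟨i, hi, rfl⟩
      exact ⟨i.castSucc, by simpa using hi, by simp⟩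

lemma IsCanonicalSet.card_filter {r : ℕ} {ℓ : Fin r → ℕ} {x : Fin r → ℕ → Fin n → ℂ}
    (h : IsCanonicalSet F z₀ ℓ x) {m : ℕ} (hm : 0 < m) :
    ((Finset.univ.val.map ℓ).filter (m ≤ ·)).card = Module.finrank ℂ (headSpace F z₀ m) := by
  rw [← h.card_le_length hm, Multiset.filter_map, Multiset.card_map, Fintype.card_subtype]
  rfl

lemma IsCanonicalSet.zero_notMem {r : ℕ} {ℓ : Fin r → ℕ} {x : Fin r → ℕ → Fin n → ℂ}
    (h : IsCanonicalSet F z₀ ℓ x) : 0 ∉ Finset.univ.val.map ℓ := by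
  intro h0
  obtain ⟨i, -, hi⟩ := Multiset.mem_map.1 h0
  exact (h.isJordanChain i).length_pos.ne' hi

/-- A multiset of positive numbers is determined by the numbers of its elements above each
threshold. -/
lemma eq_of_card_filter_le_eq {s t : Multiset ℕ} (hs : 0 ∉ s) (ht : 0 ∉ t)
    (h : ∀ m, 0 < m → (s.filter (m ≤ ·)).card = (t.filter (m ≤ ·)).card) : s = t := by
  have key : ∀ (u : Multiset ℕ) (m : ℕ),
      (u.filter (m ≤ ·)).card = u.count m + (u.filter (m + 1 ≤ ·)).card := by
    intro u m
    simp only [← Multiset.countP_eq_card_filter]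
    induction u using Multiset.induction_on with
    | empty => simp
    | cons a u ih =>
      simp only [Multiset.countP_cons, Multiset.count_cons, ih]
      grind
  ext m
  rcases Nat.eq_zero_or_pos m with rfl | hm
  · rw [Multiset.count_eq_zero_of_notMem hs, Multiset.count_eq_zero_of_notMem ht]
  · have h1 := key s m
    have h2 := key t m
    rw [h m hm, h (m + 1) m.succ_pos] at h1
    lia

/-- The Jordan structure is the conjugate of the sequence of dimensions of the spaces of leading
vectors. -/
theorem hasJordanStructure_iff {s : Multiset ℕ} :
    HasJordanStructure F z₀ s ↔ 0 ∉ s ∧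
      ∀ m, 0 < m → (s.filter (m ≤ ·)).card = Module.finrank ℂ (headSpace F z₀ m) := by
  constructor
  · rintro ⟨r, ℓ, x, h, rfl⟩
    exact ⟨h.zero_notMem, fun m hm => h.card_filter hm⟩
  · rintro ⟨h0, hs⟩
    have hL : headSpace F z₀ (s.sum + 1) = ⊥ := by
      rw [← Submodule.finrank_eq_zero, ← hs _ (Nat.succ_pos _), Multiset.card_eq_zero,
        Multiset.filter_eq_nil]
      intro a ha
      have := Multiset.le_sum_of_mem ha
      lia
    obtain ⟨r, ℓ, x, h⟩ := exists_isCanonicalSet hL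
    refine ⟨r, ℓ, x, h, eq_of_card_filter_le_eq h0 h.zero_notMem fun m hm => ?_⟩
    rw [hs m hm, h.card_filter hm]

lemma HasJordanStructure.unique {s t : Multiset ℕ} (hs : HasJordanStructure F z₀ s)
    (ht : HasJordanStructure F z₀ t) : s = t := by
  rw [hasJordanStructure_iff] at hs ht
  exact eq_of_card_filter_le_eq hs.1 ht.1 fun m hm => by rw [hs.2 m hm, ht.2 m hm]

lemma hasJordanStructure_congr {G : ℂ → Matrix (Fin n) (Fin n) ℂ} {w₀ : ℂ}
    (h : ∀ m, headSpace F z₀ m = headSpace G w₀ m) (s : Multiset ℕ) :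
    HasJordanStructure F z₀ s ↔ HasJordanStructure G w₀ s := by
  rw [hasJordanStructure_iff, hasJordanStructure_iff, show headSpace F z₀ = headSpace G w₀ from
    funext h]

/-- A number `m` is at most `2 * k` if and only if `⌈m / 2⌉` is at most `k`. -/
lemma HasJordanStructure.map_two_mul {G : ℂ → Matrix (Fin n) (Fin n) ℂ} {w₀ : ℂ}
    (h : ∀ m, headSpace G w₀ m = headSpace F z₀ ((m + 1) / 2)) {s : Multiset ℕ}
    (hs : HasJordanStructure F z₀ s) : HasJordanStructure G w₀ (s.map (fun k => 2 * k)) := by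
  rw [hasJordanStructure_iff] at hs ⊢
  refine ⟨fun h0 => ?_, fun m hm => ?_⟩
  · obtain ⟨k, hk, hk0⟩ := Multiset.mem_map.1 h0
    obtain rfl : k = 0 := by lia
    exact hs.1 hk
  · rw [h, ← hs.2 _ (by lia), Multiset.filter_map, Multiset.card_map]
    congr 1
    refine Multiset.filter_congr fun k _ => ?_
    simp only [Function.comp_apply]
    lia

/-! ### Taylor series as formal power series -/

/-- The Taylor series of `f` at `z₀`, as a formal power series in `z - z₀`. -/
noncomputable def taylorSeries (f : ℂ → ℂ) (z₀ : ℂ) : PowerSeries ℂ :=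
  PowerSeries.mk fun k => iteratedDeriv k f z₀ / (k ! : ℂ)

lemma taylorSeries_const (c z₀ : ℂ) : taylorSeries (fun _ => c) z₀ = PowerSeries.C c := by
  ext k
  rw [taylorSeries, PowerSeries.coeff_mk, iteratedDeriv_const, PowerSeries.coeff_C]
  split_ifs with h <;> simp [h]

lemma taylorSeries_id (z₀ : ℂ) :
    taylorSeries (fun z => z) z₀ = PowerSeries.X + PowerSeries.C z₀ := by
  ext k
  rw [taylorSeries, PowerSeries.coeff_mk, iteratedDeriv_fun_id, map_add, PowerSeries.coeff_C,
    PowerSeries.coeff_X]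
  rcases k with _ | _ | k <;> simp

lemma taylorSeries_add {f g : ℂ → ℂ} {z₀ : ℂ} (hf : AnalyticAt ℂ f z₀)
    (hg : AnalyticAt ℂ g z₀) :
    taylorSeries (fun z => f z + g z) z₀ = taylorSeries f z₀ + taylorSeries g z₀ := by
  ext k
  simp only [taylorSeries, PowerSeries.coeff_mk, map_add]
  rw [iteratedDeriv_fun_add hf.contDiffAt hg.contDiffAt, add_div]

lemma taylorSeries_mul {f g : ℂ → ℂ} {z₀ : ℂ} (hf : AnalyticAt ℂ f z₀)
    (hg : AnalyticAt ℂ g z₀) :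
    taylorSeries (fun z => f z * g z) z₀ = taylorSeries f z₀ * taylorSeries g z₀ := by
  ext k
  rw [PowerSeries.coeff_mul, Finset.Nat.sum_antidiagonal_eq_sum_range_succ_mk]
  simp only [taylorSeries, PowerSeries.coeff_mk]
  rw [iteratedDeriv_fun_mul hf.contDiffAt hg.contDiffAt, Finset.sum_div]
  refine Finset.sum_congr rfl fun i hi => ?_
  have hik : i ≤ k := Nat.lt_succ_iff.1 (Finset.mem_range.1 hi)
  rw [Nat.cast_choose ℂ hik]
  have h1 : (k ! : ℂ) ≠ 0 := Nat.cast_ne_zero.2 k.factorial_ne_zero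
  have h2 : (i ! : ℂ) ≠ 0 := Nat.cast_ne_zero.2 i.factorial_ne_zero
  have h3 : ((k - i) ! : ℂ) ≠ 0 := Nat.cast_ne_zero.2 (k - i).factorial_ne_zero
  field_simp

lemma analyticAt_polynomial_eval {g : ℂ → ℂ} {z₀ : ℂ} (hg : AnalyticAt ℂ g z₀)
    (p : Polynomial ℂ) : AnalyticAt ℂ (fun z => p.eval (g z)) z₀ := by
  simpa using hg.aeval_polynomial p

lemma taylorSeries_polynomial_eval {g : ℂ → ℂ} {z₀ : ℂ} (hg : AnalyticAt ℂ g z₀)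
    (p : Polynomial ℂ) :
    taylorSeries (fun z => p.eval (g z)) z₀ = Polynomial.aeval (taylorSeries g z₀) p := by
  induction p using Polynomial.induction_on with
  | C a => simpa using taylorSeries_const a z₀
  | add p q hp hq =>
    simp only [Polynomial.eval_add, map_add]
    rw [taylorSeries_add (analyticAt_polynomial_eval hg p) (analyticAt_polynomial_eval hg q),
      hp, hq]
  | monomial k a ih =>
    have h : (fun z => Polynomial.eval (g z) (Polynomial.C a * Polynomial.X ^ (k + 1))) =
        fun z => Polynomial.eval (g z) (Polynomial.C a * Polynomial.X ^ k) * g z := by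
      funext z
      simp only [Polynomial.eval_mul, Polynomial.eval_C, Polynomial.eval_pow, Polynomial.eval_X]
      ring
    rw [h, taylorSeries_mul (analyticAt_polynomial_eval hg _) hg, ih]
    simp only [map_mul, map_pow, Polynomial.aeval_X]
    ring

lemma mem_headSpace_iff_powerSeries {F : ℂ → Matrix (Fin n) (Fin n) ℂ} {z₀ : ℂ} {m : ℕ}
    {v : Fin n → ℂ} :
    v ∈ headSpace F z₀ m ↔ ∃ x : Fin n → PowerSeries ℂ,
      (∀ i, PowerSeries.constantCoeff (x i) = v i) ∧
      ∀ i, PowerSeries.X ^ m ∣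
        ((Matrix.of fun i j => taylorSeries (fun z => F z i j) z₀) *ᵥ x) i := by
  have key : ∀ (x : Fin n → PowerSeries ℂ) (k : ℕ) (i : Fin n),
      PowerSeries.coeff k (((Matrix.of fun i j => taylorSeries (fun z => F z i j) z₀) *ᵥ x) i) =
        (∑ a ∈ Finset.range (k + 1),
          taylorCoeff F z₀ (k - a) *ᵥ fun j => PowerSeries.coeff a (x j)) i := by
    intro x k i
    simp only [Matrix.mulVec, dotProduct, Matrix.of_apply, map_sum, Finset.sum_apply]
    rw [Finset.sum_comm]
    refine Finset.sum_congr rfl fun j _ => ?_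
    rw [mul_comm, PowerSeries.coeff_mul, Finset.Nat.sum_antidiagonal_eq_sum_range_succ_mk]
    exact Finset.sum_congr rfl fun a _ => by
      rw [mul_comm]
      simp [taylorSeries, taylorCoeff]
  constructor
  · rintro ⟨x, rfl, hx⟩
    refine ⟨fun i => PowerSeries.mk fun k => x k i, fun i => by simp, fun i => ?_⟩
    rw [PowerSeries.X_pow_dvd_iff]
    intro k hk
    rw [key]
    simpa using congrFun (hx k hk) i
  · rintro ⟨x, hv, hx⟩
    refine ⟨fun k i => PowerSeries.coeff k (x i), funext fun i => by simp [hv], fun k hk => ?_⟩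
    funext i
    rw [← key]
    exact PowerSeries.X_pow_dvd_iff.1 (hx i) k hk

/-! ### Expansions along a power series of positive order -/

section Expansion

variable {U ψ : PowerSeries ℂ} {e : ℕ}

lemma constantCoeff_aeval (hψ : PowerSeries.constantCoeff ψ = 0) (p : Polynomial ℂ) :
    PowerSeries.constantCoeff (Polynomial.aeval ψ p) = p.coeff 0 := by
  rw [Polynomial.aeval_def, Polynomial.hom_eval₂, hψ, Polynomial.eval₂_at_zero]
  simp

/-- Modulo any power of `X`, a power series is a combination of `1, X, …, X ^ (e - 1)` with
polynomials in `ψ` as coefficients, if `ψ` has order `e`. -/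
lemma exists_expansion (he : 0 < e) (hU : PowerSeries.constantCoeff U ≠ 0)
    (hψ : ψ = PowerSeries.X ^ e * U) (f : PowerSeries ℂ) (m : ℕ) :
    ∃ y : ℕ → Polynomial ℂ, PowerSeries.X ^ m ∣
      f - ∑ k ∈ Finset.range e, PowerSeries.X ^ k * Polynomial.aeval ψ (y k) := by
  induction m with
  | zero => exact ⟨0, by simp⟩
  | succ m ih =>
    obtain ⟨y, h, hh⟩ := ih
    set c : ℂ := PowerSeries.constantCoeff h / PowerSeries.constantCoeff U ^ (m / e) with hc
    -- The error `X ^ m * h` is corrected by a multiple of `X ^ (m % e) * ψ ^ (m / e)`,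
    -- which has order `m`.
    refine ⟨Function.update y (m % e)
      (y (m % e) + Polynomial.C c * Polynomial.X ^ (m / e)), ?_⟩
    have hk : m % e ∈ Finset.range e := Finset.mem_range.2 (Nat.mod_lt _ he)
    have hupd : ∑ k ∈ Finset.range e, PowerSeries.X ^ k * Polynomial.aeval ψ
          (Function.update y (m % e) (y (m % e) + Polynomial.C c * Polynomial.X ^ (m / e)) k) =
        ∑ k ∈ Finset.range e, PowerSeries.X ^ k * Polynomial.aeval ψ (y k) +
          PowerSeries.X ^ m * (PowerSeries.C c * U ^ (m / e)) := by
      have hterm : (PowerSeries.X : PowerSeries ℂ) ^ m * (PowerSeries.C c * U ^ (m / e)) =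
          PowerSeries.X ^ (m % e) * (PowerSeries.C c * ψ ^ (m / e)) := by
        conv_lhs => rw [← Nat.mod_add_div m e]
        rw [hψ, pow_add, pow_mul, mul_pow]
        simp only [Nat.mod_add_div]
        ring
      rw [← Finset.add_sum_erase _ _ hk, ← Finset.add_sum_erase _ _ hk, Function.update_self,
        hterm, Finset.sum_congr rfl fun k hk' => by
          rw [Function.update_of_ne (Finset.ne_of_mem_erase hk')]]
      simp only [map_add, map_mul, map_pow, Polynomial.aeval_X, Polynomial.aeval_C,
        PowerSeries.algebraMap_apply, Algebra.algebraMap_self, RingHom.id_apply]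
      ring
    rw [hupd, ← sub_sub, hh, ← mul_sub, pow_succ]
    refine mul_dvd_mul_left _ (PowerSeries.X_dvd_iff.2 ?_)
    simp only [map_sub, map_mul, map_pow, PowerSeries.constantCoeff_C, hc]
    field_simp
    simp

/-- The terms `X ^ k * ψ ^ j` with `k < e` have the distinct orders `e * j + k`, so that none
of those of order less than `m` occurs in a combination divisible by `X ^ m`. -/
lemma coeff_eq_zero_of_dvd_expansion (hU : PowerSeries.constantCoeff U ≠ 0)
    (hψ : ψ = PowerSeries.X ^ e * U) (g : ℕ → Polynomial ℂ) (m : ℕ)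
    (hg : PowerSeries.X ^ m ∣
      ∑ k ∈ Finset.range e, PowerSeries.X ^ k * Polynomial.aeval ψ (g k)) :
    ∀ k < e, ∀ j, e * j + k < m → (g k).coeff j = 0 := by
  induction m with
  | zero => simp
  | succ m ih =>
    have ih := ih ((pow_dvd_pow _ m.le_succ).trans hg)
    intro k₀ hk₀ j₀ hlt
    rcases (Nat.lt_succ_iff.1 hlt).lt_or_eq with hlt' | rfl
    · exact ih k₀ hk₀ j₀ hlt'
    have hdvd : ∀ k < e, ∀ j, e * j + k < e * j₀ + k₀ + e →
        ∃ h : Polynomial ℂ, g k = Polynomial.X ^ j * h := by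
      intro k hk j hj
      refine Polynomial.X_pow_dvd_iff.2 fun d hd => ih k hk d ?_
      have : e * (d + 1) ≤ e * j := Nat.mul_le_mul_left e hd
      lia
    have haev : ∀ (j : ℕ) (h : Polynomial ℂ), Polynomial.aeval ψ (Polynomial.X ^ j * h) =
        PowerSeries.X ^ (e * j) * (U ^ j * Polynomial.aeval ψ h) := by
      intro j h
      rw [map_mul, map_pow, Polynomial.aeval_X, hψ, mul_pow, pow_mul, mul_assoc]
    have hrest : ∀ k ∈ (Finset.range e).erase k₀, PowerSeries.X ^ (e * j₀ + k₀ + 1) ∣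
        PowerSeries.X ^ k * Polynomial.aeval ψ (g k) := by
      intro k hk
      obtain ⟨hne, hke⟩ := Finset.mem_erase.1 hk
      rw [Finset.mem_range] at hke
      rcases hne.lt_or_gt with h | h
      · obtain ⟨q, hq⟩ := hdvd k hke (j₀ + 1) (by lia)
        rw [hq, haev, ← mul_assoc, ← pow_add]
        exact Dvd.dvd.mul_right (pow_dvd_pow _ (by lia)) _
      · obtain ⟨q, hq⟩ := hdvd k hke j₀ (by lia)
        rw [hq, haev, ← mul_assoc, ← pow_add]
        exact Dvd.dvd.mul_right (pow_dvd_pow _ (by lia)) _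
    obtain ⟨q, hq⟩ := hdvd k₀ hk₀ j₀ (by lia)
    rw [← Finset.add_sum_erase _ _ (Finset.mem_range.2 hk₀),
      dvd_add_left (Finset.dvd_sum hrest), hq, haev, ← mul_assoc, ← pow_add,
      add_comm k₀, pow_succ] at hg
    have h0 := PowerSeries.X_dvd_iff.1
      ((mul_dvd_mul_iff_left (pow_ne_zero _ PowerSeries.X_ne_zero)).1 hg)
    have hψ0 : PowerSeries.constantCoeff ψ = 0 := by simp [hψ, (show e ≠ 0 by lia)]
    rw [map_mul, map_pow, constantCoeff_aeval hψ0] at h0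
    rw [hq, Polynomial.coeff_X_pow_mul']
    simpa using (mul_eq_zero.1 h0).resolve_left (pow_ne_zero _ hU)

end Expansion

/-! ### Composition with a function of finite ramification -/

/-- The matrix polynomial `s ↦ M (y₀ + s)`. -/
noncomputable def shift (M : Matrix (Fin n) (Fin n) (Polynomial ℂ)) (y₀ : ℂ) :
    Matrix (Fin n) (Fin n) (Polynomial ℂ) :=
  M.map (Polynomial.taylor y₀)

lemma det_shift_ne_zero {M : Matrix (Fin n) (Fin n) (Polynomial ℂ)} (hM : M.det ≠ 0) (y₀ : ℂ) :
    (shift M y₀).det ≠ 0 := by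
  have h : (shift M y₀).det = Polynomial.taylorAlgHom y₀ M.det :=
    (AlgHom.map_det (Polynomial.taylorAlgHom y₀) M).symm
  rw [h]
  exact fun h0 => hM (Polynomial.taylor_injective y₀ (by simpa using h0))

lemma aeval_mulVec {m : ℕ} (ψ : PowerSeries ℂ) (A : Matrix (Fin m) (Fin n) (Polynomial ℂ))
    (y : Fin n → Polynomial ℂ) (i : Fin m) :
    (A.map (Polynomial.aeval ψ) *ᵥ fun j => Polynomial.aeval ψ (y j)) i =
      Polynomial.aeval ψ ((A *ᵥ y) i) := by
  simp [Matrix.mulVec, dotProduct]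

/-- If `g` takes the value `y₀` at `z₀` with multiplicity `e`, then the spaces of leading vectors
of `M ∘ g` at `z₀` are described by the matrix polynomial `M` alone, and depend on `m` through
`⌈m / e⌉` only. In an expansion `x = ∑ k < e, (z - z₀) ^ k • y k (g z - y₀)` of a vector function,
`M ∘ g` acts on each `y k` separately, and `y 0` has the leading vector of `x`. -/
theorem mem_headSpace_comp_iff (M : Matrix (Fin n) (Fin n) (Polynomial ℂ)) {g : ℂ → ℂ}
    {z₀ y₀ : ℂ} (hg : AnalyticAt ℂ g z₀) {e : ℕ} (he : 0 < e) {U : PowerSeries ℂ}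
    (hU : PowerSeries.constantCoeff U ≠ 0)
    (hgU : taylorSeries g z₀ = PowerSeries.X ^ e * U + PowerSeries.C y₀) (m : ℕ)
    (v : Fin n → ℂ) :
    v ∈ headSpace (fun z => evalFun M (g z)) z₀ m ↔ ∃ y : Fin n → Polynomial ℂ,
      (∀ i, (y i).coeff 0 = v i) ∧
        ∀ i, Polynomial.X ^ ((m + e - 1) / e) ∣ (shift M y₀ *ᵥ y) i := by
  obtain ⟨ψ, hψ⟩ : ∃ ψ, ψ = PowerSeries.X ^ e * U := ⟨_, rfl⟩
  have hψ0 : PowerSeries.constantCoeff ψ = 0 := by simp [hψ, he.ne']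
  have hN : (Matrix.of fun i j => taylorSeries (fun z => evalFun M (g z) i j) z₀) =
      (shift M y₀).map (Polynomial.aeval ψ) := by
    ext1 i j
    simp only [Matrix.of_apply, evalFun, Matrix.map_apply, shift, Polynomial.taylor_apply]
    rw [taylorSeries_polynomial_eval hg, hgU, Polynomial.aeval_comp, hψ]
    simp
  rw [mem_headSpace_iff_powerSeries, hN]
  constructor
  · rintro ⟨x, hv, hx⟩
    choose y hy using fun i => exists_expansion he hU hψ (x i) (m + 1)
    choose r hr using hy
    have hx' : ∀ i, x i = (∑ k ∈ Finset.range e,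
        PowerSeries.X ^ k * Polynomial.aeval ψ (y i k)) + PowerSeries.X ^ (m + 1) * r i :=
      fun i => by rw [← hr i]; ring
    refine ⟨fun i => y i 0, fun i => ?_, fun i => ?_⟩
    · rw [← hv i, hx' i, map_add, map_sum,
        Finset.sum_eq_single_of_mem 0 (Finset.mem_range.2 he) fun k _ hk => by simp [hk]]
      simp [constantCoeff_aeval hψ0]
    · have hdvd : PowerSeries.X ^ m ∣ ∑ k ∈ Finset.range e, PowerSeries.X ^ k *
          Polynomial.aeval ψ ((shift M y₀ *ᵥ fun j => y j k) i) := by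
        have hsum : ((shift M y₀).map (Polynomial.aeval ψ) *ᵥ x) i =
            (∑ k ∈ Finset.range e, PowerSeries.X ^ k *
              Polynomial.aeval ψ ((shift M y₀ *ᵥ fun j => y j k) i)) +
            PowerSeries.X ^ (m + 1) * ((shift M y₀).map (Polynomial.aeval ψ) *ᵥ r) i := by
          have hxs : x = (∑ k ∈ Finset.range e,
              (PowerSeries.X : PowerSeries ℂ) ^ k • fun j => Polynomial.aeval ψ (y j k)) +
                (PowerSeries.X : PowerSeries ℂ) ^ (m + 1) • r := by
            funext j
            simpa using hx' j
          rw [hxs, Matrix.mulVec_add, Matrix.mulVec_sum, Matrix.mulVec_smul]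
          simp only [Matrix.mulVec_smul, Pi.add_apply, Finset.sum_apply, Pi.smul_apply,
            smul_eq_mul, aeval_mulVec]
        have := hx i
        rw [hsum] at this
        exact (dvd_add_left (Dvd.dvd.mul_right (pow_dvd_pow _ m.le_succ) _)).1 this
      refine Polynomial.X_pow_dvd_iff.2 fun d hd => ?_
      refine coeff_eq_zero_of_dvd_expansion hU hψ
        (fun k => (shift M y₀ *ᵥ fun j => y j k) i) m hdvd 0 he d ?_
      have h1 : e * (d + 1) ≤ m + e - 1 :=
        (Nat.mul_le_mul_left e hd).trans (Nat.mul_div_le _ _)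
      rw [mul_add] at h1
      lia
  · rintro ⟨y, hv, hy⟩
    refine ⟨fun i => Polynomial.aeval ψ (y i), fun i => ?_, fun i => ?_⟩
    · rw [constantCoeff_aeval hψ0, hv]
    · rw [aeval_mulVec]
      obtain ⟨q, hq⟩ := hy i
      rw [hq, map_mul, map_pow, Polynomial.aeval_X, hψ, mul_pow, ← pow_mul, mul_assoc]
      refine Dvd.dvd.mul_right (pow_dvd_pow _ ?_) _
      have := Nat.div_add_mod (m + e - 1) e
      have := Nat.mod_lt (m + e - 1) he
      lia

lemma mem_headSpace_evalFun_iff (M : Matrix (Fin n) (Fin n) (Polynomial ℂ)) (y₀ : ℂ) (m : ℕ)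
    (v : Fin n → ℂ) :
    v ∈ headSpace (evalFun M) y₀ m ↔ ∃ y : Fin n → Polynomial ℂ,
      (∀ i, (y i).coeff 0 = v i) ∧ ∀ i, Polynomial.X ^ m ∣ (shift M y₀ *ᵥ y) i := by
  simpa using mem_headSpace_comp_iff M (g := fun z => z) analyticAt_id one_pos (U := 1)
    (by simp) (by rw [taylorSeries_id, pow_one, mul_one]) m v

/-- A function that takes the value `y₀` with multiplicity `e` multiplies the lengths of Jordan
chains by `e`. -/
theorem headSpace_comp (M : Matrix (Fin n) (Fin n) (Polynomial ℂ)) {g : ℂ → ℂ}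
    {z₀ y₀ : ℂ} (hg : AnalyticAt ℂ g z₀) {e : ℕ} (he : 0 < e) {U : PowerSeries ℂ}
    (hU : PowerSeries.constantCoeff U ≠ 0)
    (hgU : taylorSeries g z₀ = PowerSeries.X ^ e * U + PowerSeries.C y₀) (m : ℕ) :
    headSpace (fun z => evalFun M (g z)) z₀ m = headSpace (evalFun M) y₀ ((m + e - 1) / e) := by
  ext v
  rw [mem_headSpace_comp_iff M hg he hU hgU, mem_headSpace_evalFun_iff]

/-! ### Regular matrix polynomials -/

/-- Multiplying by the adjugate shows that the lengths of the Jordan chains of a regular matrix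
polynomial are bounded by the multiplicity of the zero of its determinant. -/
lemma exists_headSpace_eq_bot {M : Matrix (Fin n) (Fin n) (Polynomial ℂ)} (hM : M.det ≠ 0)
    (y₀ : ℂ) : ∃ L, headSpace (evalFun M) y₀ L = ⊥ := by
  set A := shift M y₀ with hA
  refine ⟨A.det.natDegree + 1, (Submodule.eq_bot_iff _).2 fun v hv => ?_⟩
  obtain ⟨y, hyv, hy⟩ := (mem_headSpace_evalFun_iff M y₀ _ v).1 hv
  funext i
  rw [← hyv i, Pi.zero_apply]
  by_contra h0
  have hadj : Polynomial.X ^ (A.det.natDegree + 1) ∣ A.det * y i := by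
    have : A.det * y i = (A.adjugate *ᵥ (A *ᵥ y)) i := by
      rw [Matrix.mulVec_mulVec, Matrix.adjugate_mul, Matrix.smul_mulVec, Matrix.one_mulVec,
        Pi.smul_apply, smul_eq_mul]
    rw [this]
    change _ ∣ ∑ j, A.adjugate i j * (A *ᵥ y) j
    exact Finset.dvd_sum fun j _ => (hy j).mul_left _
  have hdvd := Polynomial.prime_X.pow_dvd_of_dvd_mul_right _
    (fun hX => h0 (Polynomial.X_dvd_iff.1 hX)) hadj
  have := Polynomial.natDegree_le_of_dvd hdvd (det_shift_ne_zero hM y₀)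
  rw [Polynomial.natDegree_X_pow] at this
  lia

lemma exists_hasJordanStructure {M : Matrix (Fin n) (Fin n) (Polynomial ℂ)} (hM : M.det ≠ 0)
    (y₀ : ℂ) : ∃ s, HasJordanStructure (evalFun M) y₀ s := by
  obtain ⟨L, hL⟩ := exists_headSpace_eq_bot hM y₀
  obtain ⟨r, ℓ, x, h⟩ := exists_isCanonicalSet hL
  exact ⟨_, r, ℓ, x, h, rfl⟩

/-! ### The function `z + 1 / z` -/

lemma analyticAt_add_inv {z₀ : ℂ} (hz : z₀ ≠ 0) : AnalyticAt ℂ (fun z => z + z⁻¹) z₀ :=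
  analyticAt_id.add (analyticAt_id.inv hz)

/-- The expansion `z + 1 / z - (z₀ + 1 / z₀) = (z - z₀) * (z - 1 / z₀) / z`. -/
lemma exists_taylorSeries_add_inv {z₀ : ℂ} (hz : z₀ ≠ 0) :
    ∃ W : PowerSeries ℂ, PowerSeries.constantCoeff W ≠ 0 ∧
      taylorSeries (fun z => z + z⁻¹) z₀ =
        PowerSeries.X * (PowerSeries.X + PowerSeries.C (z₀ - z₀⁻¹)) * W +
          PowerSeries.C (z₀ + z₀⁻¹) := by
  set W := taylorSeries (fun z => z⁻¹) z₀ with hW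
  set T := PowerSeries.X + PowerSeries.C z₀ with hT
  have hinv : AnalyticAt ℂ (fun z : ℂ => z⁻¹) z₀ := analyticAt_id.inv hz
  have hadd : taylorSeries (fun z => z + z⁻¹) z₀ = T + W := by
    rw [taylorSeries_add (f := fun z => z) analyticAt_id hinv, taylorSeries_id]
  have hTW : T * W = 1 := by
    have h1 : (fun z : ℂ => z * z⁻¹) =ᶠ[nhds z₀] fun _ => 1 := by
      filter_upwards [isOpen_ne.mem_nhds hz] with z hz'
      exact mul_inv_cancel₀ hz'
    rw [hT, ← taylorSeries_id, ← taylorSeries_mul (f := fun z => z) analyticAt_id hinv,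
      ← map_one (PowerSeries.C (R := ℂ)), ← taylorSeries_const 1 z₀]
    ext k
    simp only [taylorSeries, PowerSeries.coeff_mk, h1.iteratedDeriv_eq k]
  refine ⟨W, fun h0 => ?_, ?_⟩
  · simpa [h0] using congrArg PowerSeries.constantCoeff hTW
  · have hC : PowerSeries.C z₀ * PowerSeries.C z₀⁻¹ = 1 := by
      rw [← map_mul, mul_inv_cancel₀ hz, map_one]
    rw [hadd, map_sub, map_add]
    rw [hT] at hTW ⊢
    linear_combination (PowerSeries.C z₀⁻¹ - PowerSeries.X) * hTW - W * hC

lemma headSpace_dicksonFun (M : Matrix (Fin n) (Fin n) (Polynomial ℂ)) {z₀ : ℂ} (h0 : z₀ ≠ 0)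
    (h1 : z₀ ≠ 1) (h2 : z₀ ≠ -1) (m : ℕ) :
    headSpace (dicksonFun M) z₀ m = headSpace (evalFun M) (z₀ + z₀⁻¹) m := by
  obtain ⟨W, hW, h⟩ := exists_taylorSeries_add_inv h0
  have hne : z₀ - z₀⁻¹ ≠ 0 := by
    intro hz
    have hsq : (z₀ - 1) * (z₀ + 1) = 0 := by
      linear_combination z₀ * hz + mul_inv_cancel₀ h0
    rcases mul_eq_zero.1 hsq with h' | h'
    · exact h1 (sub_eq_zero.1 h')
    · exact h2 (eq_neg_of_add_eq_zero_left h')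
  have := headSpace_comp M (analyticAt_add_inv h0) one_pos
    (U := (PowerSeries.X + PowerSeries.C (z₀ - z₀⁻¹)) * W) (by simpa using ⟨hne, hW⟩)
    (by rw [h, pow_one, mul_assoc]) m
  rwa [Nat.add_sub_cancel, Nat.div_one] at this

/-- At `±1`, the function `z + 1 / z` takes its value with multiplicity two. -/
lemma headSpace_dicksonFun_branch (M : Matrix (Fin n) (Fin n) (Polynomial ℂ)) {z₀ : ℂ}
    (hz : z₀ = 1 ∨ z₀ = -1) (m : ℕ) :
    headSpace (dicksonFun M) z₀ m = headSpace (evalFun M) (2 * z₀) ((m + 1) / 2) := by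
  have h0 : z₀ ≠ 0 := by rcases hz with rfl | rfl <;> simp
  have hinv : z₀⁻¹ = z₀ := by rcases hz with rfl | rfl <;> norm_num
  obtain ⟨W, hW, h⟩ := exists_taylorSeries_add_inv h0
  exact headSpace_comp M (analyticAt_add_inv h0) two_pos hW
    (by rw [h, hinv, sub_self, map_zero, add_zero, ← sq, ← two_mul]) m

end JordanChains

theorem mainTheorem3 (n : ℕ) (M : Matrix (Fin n) (Fin n) (Polynomial ℂ)) (hM : M.det ≠ 0) :
    (∀ y₀ : ℂ, ∃! s : Multiset ℕ,
      JordanChains.HasJordanStructure (JordanChains.evalFun M) y₀ s) ∧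
    (∀ z₀ : ℂ, z₀ ≠ 0 → z₀ ≠ 1 → z₀ ≠ -1 → ∀ s : Multiset ℕ,
      (JordanChains.HasJordanStructure (JordanChains.evalFun M) (z₀ + z₀⁻¹) s ↔
        JordanChains.HasJordanStructure (JordanChains.dicksonFun M) z₀ s) ∧
      (JordanChains.HasJordanStructure (JordanChains.evalFun M) (z₀ + z₀⁻¹) s ↔
        JordanChains.HasJordanStructure (JordanChains.dicksonFun M) z₀⁻¹ s)) ∧
    (∀ z₀ : ℂ, z₀ = 1 ∨ z₀ = -1 →
      (∀ ℓ : ℕ,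
        (∃ x, JordanChains.IsJordanChain (JordanChains.evalFun M) (2 * z₀) ℓ x) ↔
          ∃ x, JordanChains.IsJordanChain (JordanChains.dicksonFun M) z₀ (2 * ℓ) x) ∧
      (∀ t : Multiset ℕ,
        JordanChains.HasJordanStructure (JordanChains.dicksonFun M) z₀ t ↔
          ∃ s : Multiset ℕ,
            JordanChains.HasJordanStructure (JordanChains.evalFun M) (2 * z₀) s ∧
              t = s.map (fun k => 2 * k))) := by
  open JordanChains in
  refine ⟨fun y₀ => ?_, fun z₀ h0 h1 h2 s => ⟨?_, ?_⟩, fun z₀ hz => ⟨fun ℓ => ?_, fun t => ?_⟩⟩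
  · obtain ⟨s, hs⟩ := exists_hasJordanStructure hM y₀
    exact ⟨s, hs, fun t ht => ht.unique hs⟩
  · exact hasJordanStructure_congr (fun m => (headSpace_dicksonFun M h0 h1 h2 m).symm) s
  · refine hasJordanStructure_congr (fun m => ?_) s
    rw [headSpace_dicksonFun M (inv_ne_zero h0) (by simpa using h1)
      (by rwa [Ne, inv_eq_iff_eq_inv, inv_neg, inv_one]), inv_inv, add_comm]
  · rw [exists_isJordanChain_iff, exists_isJordanChain_iff, headSpace_dicksonFun_branch M hz,
      show (2 * ℓ + 1) / 2 = ℓ by lia, show 0 < 2 * ℓ ↔ 0 < ℓ by lia]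
  · obtain ⟨s, hs⟩ := exists_hasJordanStructure hM (2 * z₀)
    have hN := hs.map_two_mul (headSpace_dicksonFun_branch M hz)
    constructor
    · exact fun ht => ⟨s, hs, ht.unique hN⟩
    · rintro ⟨s', hs', rfl⟩
      rwa [hs'.unique hs]
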